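/- Let $1\le r\le H$ and $N\ge 1$ be integers. In the $(H,r)$ combination network a server holds $N$ files $F_1,\dots,F_N$ of $B$ independent uniformly distributed bits each and is connected to $H$ relays (without caches) by $H$ error-free links. There are $K=\binom Hr$ users; user $k$ is connected by error-free links to the relays of a set $\mathcal H_k\subseteq\{1,\dots,H\}$ with $|\mathcal H_k|=r$, distinct users having distinct sets. Let $\mathcal U_h$ be the set of users connected to relay $h$. Before the demands are known, user $k$ stores a function $Z_k$ of the files. Then a demand vector $d=(d_1,\dots,d_K)\in\{1,\dots,N\}^K$ is revealed to all nodes; the server sends a message $X_h$ to each relay $h$, relay $h$ sends to each user $k\in\mathcal U_h$ a message $X_{h\to k}$ computed from $X_h$, and user $k$ outputs an estimate of $F_{d_k}$ from $Z_k$ and $(X_{h\to k})_{h\in\mathcal H_k}$. The max-link load of a scheme is the maximum, over all $d$ and all links, of the number of bits sent over the link divided by $B$. A pair $(M,R)$ is called achievable if for every $\varepsilon>0$ and all sufficiently large $B$ there is a scheme in which every cache has at most $MB$ bits, the max-link load is at most $R+\varepsilon$, and for every $d$ the probability that some user fails to recover its file is at most $\varepsilon$. Put $K'=\binom{H-1}{r-1}$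 and $K''=\binom{H}{r-1}$. For each integer $g$ with $2\le g\le K'$ (the coded caching gain) put $q=K'-g+1$, $D_g=\binom{K''-r}{q}+r\binom{K'-1}{q-1}$ and $$(M_g,R_g)=\left(N\,\frac{\binom{K''-r}{q}}{\binom{K''-r}{q}+r\binom{K'-1}{q-1}},\ \frac{(K/H)\,(1-M_g/N)}{g}\right).$$ (i) The lower convex envelope of the points $(M_g,R_g)$, $2\le g\le K'$, is achievable: for every $M$ in the projection of the convex hull of these points to the first coordinate, the pair $(M,R)$ with $R=\min\{y:(M,y)\in\operatorname{conv}\{(M_g,R_g):2\le g\le K'\}\}$ is achievable. (ii) Moreover, each point $(M_g,R_g)$ is attained by the following scheme with coded, topology-dependent placement, for every $b\ge1$ for which a code as described exists, and such codes exist for all sufficiently large $b$. Each file has $B=D_g b$ bits, is cut into $D_g$ pieces of $b$ bits, and is encoded by an MDS code (any $D_g$ coded symbols determine the file) into symbols $f_{i,\mathcal Q}$ of $b$ bits, one for each collection $\mathcal Q$ of $q$ distinct $(r-1)$-subsets of $\{1,\dots,H\}$. User $k$ stores $f_{i,\mathcal Q}$, for all $i$, exactly when no $\mathcal Y\in\mathcal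 Q$ is contained in $\mathcal H_k$. For each relay $h$ and each $\mathcal J\subseteq\mathcal U_h$ with $|\mathcal J|=g$, the server sends to relay $h$ the bitwise XOR $\bigoplus_{k\in\mathcal J}f_{d_k,\mathcal Q(h,\mathcal J,k)}$, where $\mathcal Q(h,\mathcal J,k)=\{\mathcal H_{k'}\setminus\{h\}:k'\in\mathcal U_h\setminus\mathcal J\}\cup\{\mathcal H_k\setminus\{h\}\}$, and relay $h$ forwards it to the users in $\mathcal J$. For every such MDS code, every cache has exactly $M_gB$ bits, the max-link load is exactly $R_g$, and for every $d$ all users recover their files with error probability $0$, user $k$ outputting the file $F_{d_k}$ of any library that is consistent with its cache and with what it received. -/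

import Mathlib

open Filter

namespace CombNet

/-- Bits; addition is XOR. -/
abbrev Bit : Type := ZMod 2

/-- A user of the `(H, r)` combination network is identified with the set `H_k` of the `r` relays
to which it is connected; every `r`-subset of the `H` relays occurs exactly once. -/
abbrev User (H r : ℕ) : Type := {S : Finset (Fin H) // S.card = r}

/-- The set `U_h` of the users connected to relay `h`. -/
def usersOf (H r : ℕ) (h : Fin H) : Finset (User H r) :=
  Finset.univ.filter fun k => h ∈ k.1

/-- The library: `N` files, the bits of each file being indexed by `ι` (so `B = |ι|`). -/
abbrev Files (N : ℕ) (ι : Type) : Type := Fin N → ι → Bit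

/-- Demand vectors: user `k` requests the file `d k`. -/
abbrev Demand (H r N : ℕ) : Type := User H r → Fin N

/-- A caching scheme for the `(H, r)` combination network with `N` files, each with bits indexed
by `ι`. All stored and transmitted contents are strings of bits, indexed by finite types. -/
structure Scheme (H r N : ℕ) (ι : Type) where
  /-- positions of the bits in the cache of user `k` -/
  CacheIx : User H r → Type
  /-- positions of the bits sent by the server to relay `h` -/
  RelayIx : Demand H r N → Fin H → Type
  /-- positions of the bits sent by relay `h` to a user `k` connected to it -/
  LinkIx : Demand H r N → (k : User H r) → {h : Fin H // h ∈ k.1} → Type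
  cacheFintype : ∀ k, Fintype (CacheIx k)
  relayFintype : ∀ d h, Fintype (RelayIx d h)
  linkFintype : ∀ d k h, Fintype (LinkIx d k h)
  /-- the cache content `Z_k`, chosen without knowledge of the demands -/
  place : ∀ k, Files N ι → (CacheIx k → Bit)
  /-- the message `X_h` from the server to relay `h` -/
  serverMsg : ∀ d h, Files N ι → (RelayIx d h → Bit)
  /-- the message `X_{h → k}`, computed by relay `h` from what it received -/
  relayMsg : ∀ d k (h : {h : Fin H // h ∈ k.1}), (RelayIx d h.1 → Bit) → (LinkIx d k h → Bit)
  /-- user `k` decodes from `Z_k` and the messages of the relays to which it is connected -/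
  decode : ∀ d k, (CacheIx k → Bit) → (∀ h : {h : Fin H // h ∈ k.1}, LinkIx d k h → Bit) →
    (ι → Bit)

namespace Scheme

variable {H r N : ℕ} {ι : Type}

/-- Number of bits in the cache of user `k`. -/
def cacheBits (s : Scheme H r N ι) (k : User H r) : ℕ :=
  @Fintype.card (s.CacheIx k) (s.cacheFintype k)

/-- Number of bits sent from the server to relay `h`. -/
def relayBits (s : Scheme H r N ι) (d : Demand H r N) (h : Fin H) : ℕ :=
  @Fintype.card (s.RelayIx d h) (s.relayFintype d h)

/-- Number of bits sent from relay `h` to user `k`. -/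
def linkBits (s : Scheme H r N ι) (d : Demand H r N) (k : User H r)
    (h : {h : Fin H // h ∈ k.1}) : ℕ :=
  @Fintype.card (s.LinkIx d k h) (s.linkFintype d k h)

/-- The file recovered by user `k` when the library is `W` and the demand vector is `d`. -/
def output (s : Scheme H r N ι) (d : Demand H r N) (W : Files N ι) (k : User H r) : ι → Bit :=
  s.decode d k (s.place k W) fun h => s.relayMsg d k h (s.serverMsg d h.1 W)

/-- All link loads, normalized by the file size `B = |ι|`, over all links and all demand
vectors; the max-link load of the scheme is the greatest element of this set. -/
noncomputable def loads [Fintype ι] (s : Scheme H r N ι) : Set ℝ :=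
  {ρ | ∃ d h, ρ = (s.relayBits d h : ℝ) / Fintype.card ι} ∪
  {ρ | ∃ d k h, ρ = (s.linkBits d k h : ℝ) / Fintype.card ι}

/-- The probability, for independent uniformly distributed file bits, that some user does not
recover its requested file. -/
noncomputable def errorProb (s : Scheme H r N ι) (d : Demand H r N) : ℝ :=
  ({W : Files N ι | ∃ k, s.output d W k ≠ W (d k)}.ncard : ℝ) / Nat.card (Files N ι)

end Scheme

/-- `(M, R)` is achievable: for every `ε > 0` and all sufficiently large file sizes `B` some
scheme uses caches of at most `M B` bits, has max-link load at most `R + ε`, and has error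
probability at most `ε` for every demand vector. -/
def Achievable (H r N : ℕ) (M R : ℝ) : Prop :=
  ∀ ε : ℝ, 0 < ε → ∀ᶠ B : ℕ in atTop, ∃ s : Scheme H r N (Fin B),
    (∀ k, (s.cacheBits k : ℝ) ≤ M * B) ∧ (∀ ρ ∈ s.loads, ρ ≤ R + ε) ∧
    ∀ d, s.errorProb d ≤ ε

/-- The lower convex envelope of a set of points of the plane, as a function of the abscissa
(meaningful on the projection of the convex hull to the first coordinate). -/
noncomputable def lowerConvexEnvelope (S : Set (ℝ × ℝ)) (x : ℝ) : ℝ :=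
  sInf {y | (x, y) ∈ convexHull ℝ S}

/-- `K' = C(H-1, r-1)`, the number of users connected to each relay. -/
def K' (H r : ℕ) : ℕ := (H - 1).choose (r - 1)

/-- `K'' = C(H, r-1)`, the number of sets of `r - 1` relays. -/
def K'' (H r : ℕ) : ℕ := H.choose (r - 1)

/-- `q = K' - g + 1`. -/
def q (H r g : ℕ) : ℕ := K' H r - g + 1

/-- `C(K''-r, q) + r C(K'-1, q-1)`. -/
def numPieces (H r g : ℕ) : ℕ :=
  (K'' H r - r).choose (q H r g) + r * (K' H r - 1).choose (q H r g - 1)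

/-- The memory size of the point with coded caching gain `g`. -/
noncomputable def memory (H r N g : ℕ) : ℝ :=
  N * (((K'' H r - r).choose (q H r g) : ℝ) /
    (((K'' H r - r).choose (q H r g) : ℝ) + r * ((K' H r - 1).choose (q H r g - 1) : ℝ)))

/-- The max-link load of the point with coded caching gain `g`, where `K = C(H, r)`. -/
noncomputable def load (H r N g : ℕ) : ℝ :=
  ((H.choose r : ℝ) / H * (1 - memory H r N g / N)) / g

/-- The points `(M, R)` for `g ∈ [2 : K']`. -/
noncomputable def points (H r N : ℕ) : Set (ℝ × ℝ) :=
  (fun g : ℕ => (memory H r N g, load H r N g)) '' Set.Icc 2 (K' H r)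

/-- An encoder of `D` symbols of an alphabet `A` into symbols of `A` indexed by `κ` is MDS if any
`D` of the coded symbols determine the message. -/
def IsMDS {D : ℕ} {A κ : Type} (enc : (Fin D → A) → κ → A) : Prop :=
  ∀ T : Finset κ, T.card = D → Function.Injective fun (x : Fin D → A) (t : T) => enc x t.1

/-- The collections `Q` of `q` sets of `r - 1` relays each. -/
abbrev Collection (H r g : ℕ) : Type :=
  {Q : Finset (Finset (Fin H)) // Q ∈ ((Finset.univ : Finset (Fin H)).powersetCard
    (r - 1)).powersetCard (q H r g)}

/-- User `k` caches the coded symbols with index `Q` if it is in no `P_Y`, `Y ∈ Q`, where `P_Y`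
is the set of users connected to all the relays in `Y`. -/
def Caches {H r : ℕ} (k : User H r) (Q : Finset (Finset (Fin H))) : Prop :=
  ∀ Y ∈ Q, ¬ Y ⊆ k.1

instance {H r : ℕ} (k : User H r) (Q : Finset (Finset (Fin H))) : Decidable (Caches k Q) := by
  unfold Caches; infer_instance

/-- The collection `{H_k' \ {h} : k' ∈ U_h \ J} ∪ {H_k \ {h}}`. -/
def multicastCollection {H r : ℕ} (h : Fin H) (J : Finset (User H r)) (k : User H r) :
    Finset (Finset (Fin H)) :=
  insert (k.1.erase h) ((usersOf H r h \ J).image fun k' => k'.1.erase h)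

theorem erase_injOn {H r : ℕ} (h : Fin H) {k k' : User H r} (hk : k ∈ usersOf H r h)
    (hk' : k' ∈ usersOf H r h) (e : k.1.erase h = k'.1.erase h) : k = k' := by
  simp only [usersOf, Finset.mem_filter, Finset.mem_univ, true_and] at hk hk'
  apply Subtype.ext
  rw [← Finset.insert_erase hk, e, Finset.insert_erase hk']

theorem card_usersOf {H r : ℕ} (hr : 1 ≤ r) (h : Fin H) :
    (usersOf H r h).card = K' H r := by
  have key : (usersOf H r h).card =
      ((Finset.univ.erase h : Finset (Fin H)).powersetCard (r - 1)).card := by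
    refine Finset.card_bij (fun k _ => k.1.erase h) ?_ ?_ ?_
    · intro k hk
      have hk2 : h ∈ k.1 := by simpa [usersOf] using hk
      rw [Finset.mem_powersetCard]
      refine ⟨Finset.erase_subset_erase _ (Finset.subset_univ _), ?_⟩
      rw [Finset.card_erase_of_mem hk2, k.2]
    · intro k hk k' hk' e
      exact erase_injOn h hk hk' e
    · intro Y hY
      rw [Finset.mem_powersetCard] at hY
      have hh : h ∉ Y := fun hc => by simpa using hY.1 hc
      refine ⟨⟨insert h Y, ?_⟩, ?_, ?_⟩
      · rw [Finset.card_insert_of_notMem hh, hY.2]; omega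
      · simp [usersOf]
      · simp [Finset.erase_insert hh]
  rw [key, Finset.card_powersetCard, Finset.card_erase_of_mem (Finset.mem_univ _)]
  simp [K']

theorem multicastCollection_mem {H r g : ℕ} {h : Fin H} {J : Finset (User H r)}
    (hJ : J ⊆ usersOf H r h) (hg : J.card = g) {k : User H r} (hk : k ∈ J) :
    multicastCollection h J k ∈ ((Finset.univ : Finset (Fin H)).powersetCard
      (r - 1)).powersetCard (q H r g) := by
  have hmem : ∀ k' ∈ usersOf H r h, (k'.1.erase h).card = r - 1 := by
    intro k' hk'
    have hk2 : h ∈ k'.1 := by simpa [usersOf] using hk'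
    rw [Finset.card_erase_of_mem hk2, k'.2]
  have hr : 1 ≤ r := by
    have hk2 : h ∈ k.1 := by simpa [usersOf] using hJ hk
    rw [← k.2]; exact Finset.card_pos.mpr ⟨h, hk2⟩
  rw [Finset.mem_powersetCard]
  constructor
  · intro Y hY
    rw [multicastCollection, Finset.mem_insert, Finset.mem_image] at hY
    rw [Finset.mem_powersetCard]
    refine ⟨Finset.subset_univ _, ?_⟩
    rcases hY with rfl | ⟨k', hk', rfl⟩
    · exact hmem k (hJ hk)
    · exact hmem k' (Finset.mem_sdiff.mp hk').1
  · rw [multicastCollection, Finset.card_insert_of_notMem, Finset.card_image_of_injOn,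
      Finset.card_sdiff_of_subset hJ, card_usersOf hr, hg, q]
    · intro a ha b hb e
      exact erase_injOn h (Finset.mem_sdiff.mp ha).1 (Finset.mem_sdiff.mp hb).1 e
    · intro hc
      obtain ⟨k', hk', e⟩ := Finset.mem_image.mp hc
      have hkk := erase_injOn h (Finset.mem_sdiff.mp hk').1 (hJ hk) e
      exact (Finset.mem_sdiff.mp hk').2 (hkk ▸ hk)

/-- The sets `J ⊆ U_h` of `g` users. -/
abbrev Group (H r g : ℕ) (h : Fin H) : Type :=
  {J : Finset (User H r) // J ⊆ usersOf H r h ∧ J.card = g}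

/-- The multicast message `W^h_J`: the XOR over `k ∈ J` of the coded symbols, of the files
requested by the users `k`, with index the collection of `h`, `J` and `k`. -/
def multicast {H r N g b : ℕ}
    (enc : (Fin (numPieces H r g) → Fin b → Bit) → Collection H r g → Fin b → Bit)
    (d : Demand H r N) (h : Fin H) (W : Files N (Fin (numPieces H r g) × Fin b))
    (J : Group H r g h) : Fin b → Bit :=
  ∑ k ∈ J.1.attach, enc (Function.curry (W (d k.1)))
    ⟨multicastCollection h J.1 k.1, multicastCollection_mem J.2.1 J.2.2 k.2⟩

/-- The scheme with asymmetric coded placement. Each file is cut into `numPieces H r g` pieces of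
`b` bits, which `enc` encodes into one symbol of `b` bits per collection `Q`; user `k` stores the
coded symbols of all files for the collections `Q` with `Caches k Q`. The server sends to relay
`h` all the messages `W^h_J`, and relay `h` forwards `W^h_J` to the users in `J`. A user outputs
its requested file in some library that is consistent with what it has stored and received. -/
noncomputable def codedScheme (H r N g b : ℕ)
    (enc : (Fin (numPieces H r g) → Fin b → Bit) → Collection H r g → Fin b → Bit) :
    Scheme H r N (Fin (numPieces H r g) × Fin b) where
  CacheIx k := (Fin N × {Q : Collection H r g // Caches k Q.1}) × Fin b
  RelayIx _ h := Group H r g h × Fin b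
  LinkIx _ k h := {J : Group H r g h.1 // k ∈ J.1} × Fin b
  cacheFintype _ := inferInstance
  relayFintype _ _ := inferInstance
  linkFintype _ _ _ := inferInstance
  place _ W := fun p => enc (Function.curry (W p.1.1)) p.1.2.1 p.2
  serverMsg d h W := fun p => multicast enc d h W p.1 p.2
  relayMsg _ _ _ x := fun p => x (p.1.1, p.2)
  decode d k z y :=
    Classical.epsilon (fun W : Files N (Fin (numPieces H r g) × Fin b) =>
      (∀ p : (Fin N × {Q : Collection H r g // Caches k Q.1}) × Fin b,
        enc (Function.curry (W p.1.1)) p.1.2.1 p.2 = z p) ∧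
      ∀ (h : {h : Fin H // h ∈ k.1}) (p : {J : Group H r g h.1 // k ∈ J.1} × Fin b),
        multicast enc d h.1 W p.1.1 p.2 = y h p) (d k)

end CombNet

/-! Decoding rests on one observation. If `k` and `k'` are both connected to `h` and `H_k' \ {h} ⊆
H_k`, then `k' = k`, since the two sets have the same size. In the XOR for `(h, J)`, the symbol
meant for `k' ≠ k` has an index made of sets `H_k'' \ {h}` with `k'' ≠ k` (`k''` outside `J`, or
`k'' = k'`). None of these lies in `H_k`, so user `k` has cached the symbol and can cancel it
(`caches_multicastCollection`). What remains is a symbol whose index contains `H_k \ {h}`, hence an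
uncached one, and distinct pairs `(h, J)` give distinct indices (`receivedCollection_injective`).
User `k` thus knows `C(K''-r, q)` cached and `r C(K'-1, g-1)` received symbols. Their total is
exactly `D_g`, because `(g-1) + (q-1) = K'-1`, and the MDS property determines the file
(`requested_file_unique`).

For the envelope, Reed–Solomon codes supply the encoders (`exists_isMDS`). Zero-error schemes can be
concatenated on disjoint parts of the files, so the zero-error region is convex
(`convex_exactRegion`). It contains the points, hence their convex hull; bits lost to rounding are
sent uncoded and absorbed by `ε`. -/

namespace CombNet

/-! ### Cardinalities, memory and load -/

section Counting

variable {H r g : ℕ}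

theorem mem_usersOf {h : Fin H} {k : User H r} : k ∈ usersOf H r h ↔ h ∈ k.1 := by
  simp [usersOf]

theorem card_group (hr : 1 ≤ r) (h : Fin H) [Fintype (Group H r g h)] :
    Fintype.card (Group H r g h) = (K' H r).choose g := by
  rw [← card_usersOf hr h, ← Finset.card_powersetCard]
  exact Fintype.card_of_subtype _ fun J => by simp [Finset.mem_powersetCard]

theorem card_powersetCard_filter_mem {α : Type*} [DecidableEq α] {s : Finset α} {a : α}
    (ha : a ∈ s) {n : ℕ} (hn : 1 ≤ n) :
    ((s.powersetCard n).filter fun t => a ∈ t).card = (s.card - 1).choose (n - 1) := by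
  rw [← Finset.card_erase_of_mem ha, ← Finset.card_powersetCard]
  refine Finset.card_bij' (fun t _ => t.erase a) (fun t _ => insert a t) ?_ ?_ ?_ ?_
  · intro t ht
    simp only [Finset.mem_filter, Finset.mem_powersetCard] at ht ⊢
    exact ⟨Finset.erase_subset_erase _ ht.1.1, by rw [Finset.card_erase_of_mem ht.2, ht.1.2]⟩
  · intro t ht
    simp only [Finset.mem_filter, Finset.mem_powersetCard] at ht ⊢
    have hat : a ∉ t := fun hc => by simpa using ht.1 hc
    refine ⟨⟨Finset.insert_subset ha (ht.1.trans (Finset.erase_subset _ _)), ?_⟩,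
      Finset.mem_insert_self _ _⟩
    rw [Finset.card_insert_of_notMem hat, ht.2]
    omega
  · intro t ht
    exact Finset.insert_erase (Finset.mem_filter.mp ht).2
  · intro t ht
    have hat : a ∉ t := fun hc => by simpa using (Finset.mem_powersetCard.mp ht).1 hc
    exact Finset.erase_insert hat

theorem card_group_mem (hr : 1 ≤ r) (hg : 1 ≤ g) (h : Fin H) {k : User H r} (hk : h ∈ k.1)
    [Fintype {J : Group H r g h // k ∈ J.1}] :
    Fintype.card {J : Group H r g h // k ∈ J.1} = (K' H r - 1).choose (g - 1) := by
  rw [← card_usersOf hr h, ← card_powersetCard_filter_mem (mem_usersOf.mpr hk) hg,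
    ← Fintype.card_coe]
  refine Fintype.card_congr ⟨fun J => ⟨J.1.1, ?_⟩, fun J => ⟨⟨J.1, ?_⟩, ?_⟩, ?_, ?_⟩
  · simpa [Finset.mem_powersetCard] using ⟨J.1.2, J.2⟩
  · exact Finset.mem_powersetCard.mp (Finset.mem_filter.mp J.2).1
  · exact (Finset.mem_filter.mp J.2).2
  · exact fun _ => rfl
  · exact fun _ => rfl

/-- A cached index is a choice of `q` among the `(r-1)`-sets that avoid the `r` such subsets of
`H_k`. -/
theorem card_cached (hr : 1 ≤ r) (k : User H r)
    [Fintype {Q : Collection H r g // Caches k Q.1}] :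
    Fintype.card {Q : Collection H r g // Caches k Q.1} =
      (K'' H r - r).choose (q H r g) := by
  have hcard : (((Finset.univ : Finset (Fin H)).powersetCard (r - 1)) \
      (k.1.powersetCard (r - 1))).card = K'' H r - r := by
    rw [Finset.card_sdiff_of_subset (Finset.powersetCard_mono (Finset.subset_univ _)),
      Finset.card_powersetCard, Finset.card_powersetCard, k.2, Finset.card_univ, Fintype.card_fin,
      K'', ← Nat.choose_symm (Nat.sub_le r 1), Nat.sub_sub_self hr, Nat.choose_one_right]
  rw [← hcard, ← Finset.card_powersetCard, ← Fintype.card_coe]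
  refine Fintype.card_congr ⟨fun Q => ⟨Q.1.1, ?_⟩, fun Q => ⟨⟨Q.1, ?_⟩, ?_⟩, ?_, ?_⟩
  · have hQ := Finset.mem_powersetCard.mp Q.1.2
    refine Finset.mem_powersetCard.mpr ⟨fun Y hY => ?_, hQ.2⟩
    exact Finset.mem_sdiff.mpr ⟨hQ.1 hY, fun hc => Q.2 Y hY (Finset.mem_powersetCard.mp hc).1⟩
  · have hQ := Finset.mem_powersetCard.mp Q.2
    exact Finset.mem_powersetCard.mpr ⟨hQ.1.trans Finset.sdiff_subset, hQ.2⟩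
  · intro Y hY hc
    have hYm := Finset.mem_sdiff.mp ((Finset.mem_powersetCard.mp Q.2).1 hY)
    exact hYm.2 (Finset.mem_powersetCard.mpr ⟨hc, (Finset.mem_powersetCard.mp hYm.1).2⟩)
  · exact fun _ => rfl
  · exact fun _ => rfl

theorem choose_q_sub_one (hg : g ∈ Set.Icc 2 (K' H r)) :
    (K' H r - 1).choose (q H r g - 1) = (K' H r - 1).choose (g - 1) := by
  obtain ⟨h2, hK⟩ := hg
  refine Nat.choose_symm_of_eq_add ?_
  unfold q
  omega

theorem numPieces_pos (hr : 1 ≤ r) (hg : g ∈ Set.Icc 2 (K' H r)) : 0 < numPieces H r g := by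
  have h1 : 0 < (K' H r - 1).choose (q H r g - 1) := by
    rw [choose_q_sub_one hg]
    exact Nat.choose_pos (Nat.sub_le_sub_right hg.2 1)
  unfold numPieces
  positivity

theorem memory_mul_numPieces (N : ℕ) (hr : 1 ≤ r) (hg : g ∈ Set.Icc 2 (K' H r)) :
    memory H r N g * numPieces H r g = N * (K'' H r - r).choose (q H r g) := by
  have hD : (0 : ℝ) < numPieces H r g := by exact_mod_cast numPieces_pos hr hg
  have e : memory H r N g =
      N * ((K'' H r - r).choose (q H r g) : ℝ) / (numPieces H r g : ℝ) := by
    rw [memory, numPieces]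
    push_cast
    ring
  rw [e, div_mul_cancel₀ _ hD.ne']

/-- Two double counts clear the denominators: user–relay links give `K r = H K'`, and groups with a
marked member give `K' C(K'-1, g-1) = g C(K', g)`. -/
theorem load_mul_numPieces {N : ℕ} (hr : 1 ≤ r) (hrH : r ≤ H) (hN : 1 ≤ N)
    (hg : g ∈ Set.Icc 2 (K' H r)) :
    load H r N g * numPieces H r g = (K' H r).choose g := by
  have hD : (0 : ℝ) < numPieces H r g := by exact_mod_cast numPieces_pos hr hg
  have hN0 : (0 : ℝ) < N := by exact_mod_cast hN
  have hH0 : (0 : ℝ) < H := by exact_mod_cast hr.trans hrH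
  have hg0 : (0 : ℝ) < g := by exact_mod_cast (show 0 < g by have := hg.1; omega)
  have h1 : (1 - memory H r N g / N) * numPieces H r g =
      r * ((K' H r - 1).choose (g - 1) : ℝ) := by
    have hm := memory_mul_numPieces N hr hg
    have hp : (numPieces H r g : ℝ) = ((K'' H r - r).choose (q H r g) : ℝ) +
        r * ((K' H r - 1).choose (g - 1) : ℝ) := by
      rw [← choose_q_sub_one hg, numPieces]
      push_cast
      ring
    have h2 : memory H r N g / N * numPieces H r g = (K'' H r - r).choose (q H r g) := by
      rw [div_mul_eq_mul_div, hm, mul_div_cancel_left₀ _ hN0.ne']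
    rw [sub_mul, one_mul, h2]
    linarith
  have h2 : (H.choose r : ℝ) * r = H * K' H r := by
    obtain ⟨H, rfl⟩ : ∃ n, H = n + 1 := ⟨H - 1, by omega⟩
    obtain ⟨r, rfl⟩ : ∃ n, r = n + 1 := ⟨r - 1, by omega⟩
    have := Nat.add_one_mul_choose_eq H r
    simp only [K', Nat.add_sub_cancel]
    exact_mod_cast this.symm
  have h3 : (K' H r : ℝ) * (K' H r - 1).choose (g - 1) = (K' H r).choose g * g := by
    obtain ⟨n, hn⟩ : ∃ n, K' H r = n + 1 := ⟨K' H r - 1, by have := hg.1.trans hg.2; omega⟩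
    obtain ⟨g, rfl⟩ : ∃ n, g = n + 1 := ⟨g - 1, by have := hg.1; omega⟩
    have := Nat.add_one_mul_choose_eq n g
    rw [hn]
    simp only [Nat.add_sub_cancel]
    exact_mod_cast this
  calc load H r N g * numPieces H r g
      = (H.choose r : ℝ) / H * ((1 - memory H r N g / N) * numPieces H r g) / g := by
        rw [load]; ring
    _ = (H.choose r : ℝ) * r / H * (K' H r - 1).choose (g - 1) / g := by rw [h1]; ring
    _ = (K' H r : ℝ) * (K' H r - 1).choose (g - 1) / g := by
        rw [h2, mul_div_cancel_left₀ _ hH0.ne']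
    _ = (K' H r).choose g := by rw [h3, mul_div_cancel_right₀ _ hg0.ne']

end Counting

/-! ### Decodability and cost of the coded scheme -/

section CodedScheme

variable {H r N g b : ℕ}
  {enc : (Fin (numPieces H r g) → Fin b → Bit) → Collection H r g → Fin b → Bit}

theorem eq_of_erase_subset {h : Fin H} {k k' : User H r} (hk : h ∈ k.1) (hk' : h ∈ k'.1)
    (hs : k'.1.erase h ⊆ k.1) : k' = k := by
  refine erase_injOn h (mem_usersOf.mpr hk') (mem_usersOf.mpr hk)
    (Finset.eq_of_subset_of_card_le (fun x hx => ?_) ?_)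
  · exact Finset.mem_erase.mpr ⟨(Finset.mem_erase.mp hx).1, hs hx⟩
  · rw [Finset.card_erase_of_mem hk, Finset.card_erase_of_mem hk', k.2, k'.2]

/-- The other members of a group interfere only through symbols that user `k` has cached. -/
theorem caches_multicastCollection {h : Fin H} {J : Finset (User H r)} (hJ : J ⊆ usersOf H r h)
    {k k' : User H r} (hk : k ∈ J) (hk' : k' ∈ J) (hne : k' ≠ k) :
    Caches k (multicastCollection h J k') := by
  intro Y hY hs
  rw [multicastCollection, Finset.mem_insert, Finset.mem_image] at hY
  have hkh := mem_usersOf.mp (hJ hk)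
  rcases hY with rfl | ⟨k₁, hk₁, rfl⟩
  · exact hne (eq_of_erase_subset hkh (mem_usersOf.mp (hJ hk')) hs)
  · rw [Finset.mem_sdiff] at hk₁
    exact hk₁.2 (eq_of_erase_subset hkh (mem_usersOf.mp hk₁.1) hs ▸ hk)

theorem not_caches_multicastCollection (h : Fin H) (J : Finset (User H r)) (k : User H r) :
    ¬ Caches k (multicastCollection h J k) := fun hc =>
  hc _ (Finset.mem_insert_self _ _) (Finset.erase_subset _ _)

theorem notMem_of_mem_multicastCollection {h : Fin H} {J : Finset (User H r)} {k : User H r}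
    {Y : Finset (Fin H)} (hY : Y ∈ multicastCollection h J k) : h ∉ Y := by
  rw [multicastCollection, Finset.mem_insert, Finset.mem_image] at hY
  rcases hY with rfl | ⟨_, _, rfl⟩ <;> exact Finset.notMem_erase _ _

theorem erase_mem_multicastCollection {h : Fin H} {J : Finset (User H r)}
    (hJ : J ⊆ usersOf H r h) {k k' : User H r} (hk : k ∈ J) (hk' : k' ∈ usersOf H r h) :
    k'.1.erase h ∈ multicastCollection h J k ↔ k' = k ∨ k' ∉ J := by
  rw [multicastCollection, Finset.mem_insert, Finset.mem_image]
  constructor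
  · rintro (e | ⟨k₁, hk₁, e⟩)
    · exact Or.inl (erase_injOn h hk' (hJ hk) e)
    · rw [Finset.mem_sdiff] at hk₁
      exact Or.inr (erase_injOn h hk₁.1 hk' e ▸ hk₁.2)
  · rintro (rfl | hn)
    · exact Or.inl rfl
    · exact Or.inr ⟨k', Finset.mem_sdiff.mpr ⟨hk', hn⟩, rfl⟩

/-- Apart from `k`, the users of `U_h` visible in the collection are exactly those outside `J`, so
the collection reveals `J`. -/
theorem multicastCollection_injective_group {h : Fin H} {J J' : Finset (User H r)}
    (hJ : J ⊆ usersOf H r h) (hJ' : J' ⊆ usersOf H r h) {k : User H r} (hk : k ∈ J)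
    (hk' : k ∈ J') (e : multicastCollection h J k = multicastCollection h J' k) : J = J' := by
  ext k₁
  by_cases h1 : k₁ ∈ usersOf H r h
  · have := (erase_mem_multicastCollection hJ hk h1).symm.trans
      ((iff_of_eq (congrArg (k₁.1.erase h ∈ ·) e)).trans (erase_mem_multicastCollection hJ' hk' h1))
    by_cases hkk : k₁ = k
    · subst hkk; tauto
    · tauto
  · exact iff_of_false (fun hc => h1 (hJ hc)) (fun hc => h1 (hJ' hc))

/-- The multicast messages that user `k` receives. -/
abbrev Received (g : ℕ) (k : User H r) : Type :=
  (h : {h : Fin H // h ∈ k.1}) × {J : Group H r g h.1 // k ∈ J.1}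

/-- The collection that user `k` decodes from a received message. -/
def receivedCollection (k : User H r) (p : Received g k) : Collection H r g :=
  ⟨multicastCollection p.1.1 p.2.1.1 k, multicastCollection_mem p.2.1.2.1 p.2.1.2.2 p.2.2⟩

theorem receivedCollection_injective (k : User H r) :
    Function.Injective (receivedCollection (g := g) k) := by
  rintro ⟨⟨h, hk⟩, ⟨⟨J, hJ⟩, hkJ⟩⟩ ⟨⟨h', hk'⟩, ⟨⟨J', hJ'⟩, hkJ'⟩⟩ e
  have e' : multicastCollection h J k = multicastCollection h' J' k := congrArg Subtype.val e
  have hh : h = h' := by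
    by_contra hne
    -- No member of a collection built at `h` contains `h`, whereas `H_k \ {h'}` contains `h` when
    -- `h ≠ h'`. So the collection also reveals the relay.
    have hm : k.1.erase h' ∈ multicastCollection h J k := by
      rw [e']
      exact Finset.mem_insert_self _ _
    exact notMem_of_mem_multicastCollection hm (Finset.mem_erase.mpr ⟨hne, hk⟩)
  subst hh
  obtain rfl := multicastCollection_injective_group hJ.1 hJ'.1 hkJ hkJ' e'
  rfl

theorem card_received (hr : 1 ≤ r) (hg : g ∈ Set.Icc 2 (K' H r)) (k : User H r) :
    Fintype.card (Received g k) = r * (K' H r - 1).choose (q H r g - 1) := by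
  have hg1 : 1 ≤ g := by have := hg.1; omega
  rw [Fintype.card_sigma, choose_q_sub_one hg,
    Finset.sum_congr rfl fun h _ => card_group_mem hr hg1 h.1 h.2, Finset.sum_const,
    Finset.card_univ, Fintype.card_coe, k.2, smul_eq_mul]

/-- A library is determined, at the file requested by user `k`, by what user `k` stores and
receives. -/
theorem requested_file_unique (hr : 1 ≤ r) (hg : g ∈ Set.Icc 2 (K' H r)) (henc : IsMDS enc)
    (d : Demand H r N) (k : User H r) {W W' : Files N (Fin (numPieces H r g) × Fin b)}
    (hc : ∀ i (Q : Collection H r g), Caches k Q.1 →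
      enc (Function.curry (W i)) Q = enc (Function.curry (W' i)) Q)
    (hm : ∀ h ∈ k.1, ∀ J : Group H r g h, k ∈ J.1 →
      multicast enc d h W J = multicast enc d h W' J) :
    W (d k) = W' (d k) := by
  classical
  have hrec : ∀ p : Received g k, enc (Function.curry (W (d k))) (receivedCollection k p) =
      enc (Function.curry (W' (d k))) (receivedCollection k p) := by
    rintro ⟨⟨h, hk⟩, ⟨J, hkJ⟩⟩
    have e := hm h hk J hkJ
    unfold multicast at e
    -- Split off the term of `k`; all other terms are cached by `k`, so they agree for both
    -- libraries and cancel.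
    rw [← Finset.add_sum_erase _ _ (Finset.mem_attach J.1 ⟨k, hkJ⟩),
      ← Finset.add_sum_erase _ _ (Finset.mem_attach J.1 ⟨k, hkJ⟩)] at e
    have hs : ∀ k' ∈ J.1.attach.erase ⟨k, hkJ⟩,
        enc (Function.curry (W (d k'.1))) ⟨multicastCollection h J.1 k'.1,
          multicastCollection_mem J.2.1 J.2.2 k'.2⟩ =
        enc (Function.curry (W' (d k'.1))) ⟨multicastCollection h J.1 k'.1,
          multicastCollection_mem J.2.1 J.2.2 k'.2⟩ := fun k' hk' =>
      hc _ _ (caches_multicastCollection J.2.1 hkJ k'.2 fun e =>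
        (Finset.mem_erase.mp hk').1 (Subtype.ext e))
    rw [Finset.sum_congr rfl hs] at e
    exact add_right_cancel e
  let C : Finset (Collection H r g) := Finset.univ.filter fun Q => Caches k Q.1
  let R : Finset (Collection H r g) :=
    Finset.univ.map ⟨receivedCollection (g := g) k, receivedCollection_injective k⟩
  have hdisj : Disjoint C R := by
    rw [Finset.disjoint_left]
    intro Q hQ hQ'
    obtain ⟨p, -, rfl⟩ := Finset.mem_map.mp hQ'
    exact not_caches_multicastCollection _ _ _ (Finset.mem_filter.mp hQ).2
  have hT : (C ∪ R).card = numPieces H r g := by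
    rw [Finset.card_union_of_disjoint hdisj, Finset.card_map, Finset.card_univ,
      card_received hr hg, ← Fintype.card_subtype, card_cached hr, numPieces]
  refine Function.curry_injective (henc _ hT (funext fun Q => ?_))
  rcases Finset.mem_union.mp Q.2 with hQ | hQ
  · exact hc _ _ (Finset.mem_filter.mp hQ).2
  · obtain ⟨p, -, hp⟩ := Finset.mem_map.mp hQ
    have := hrec p
    rwa [show receivedCollection k p = Q.1 from hp] at this

theorem codedScheme_output (hr : 1 ≤ r) (hg : g ∈ Set.Icc 2 (K' H r)) (henc : IsMDS enc)
    (d : Demand H r N) (W : Files N (Fin (numPieces H r g) × Fin b)) (k : User H r) :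
    (codedScheme H r N g b enc).output d W k = W (d k) := by
  have key := Classical.epsilon_spec
    (p := fun W' : Files N (Fin (numPieces H r g) × Fin b) =>
      (∀ p : (Fin N × {Q : Collection H r g // Caches k Q.1}) × Fin b,
        enc (Function.curry (W' p.1.1)) p.1.2.1 p.2 =
          enc (Function.curry (W p.1.1)) p.1.2.1 p.2) ∧
      ∀ (h : {h : Fin H // h ∈ k.1}) (p : {J : Group H r g h.1 // k ∈ J.1} × Fin b),
        multicast enc d h.1 W' p.1.1 p.2 = multicast enc d h.1 W p.1.1 p.2)
    -- The true library is consistent with the observations, so the library chosen by `epsilon` is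
    -- too; uniqueness then identifies the requested file.
    ⟨W, fun _ => rfl, fun _ _ => rfl⟩
  exact requested_file_unique hr hg henc d k
    (fun i Q hQ => funext fun x => key.1 ((i, ⟨Q, hQ⟩), x))
    (fun h hk J hJ => funext fun x => key.2 ⟨h, hk⟩ (⟨J, hJ⟩, x))

theorem codedScheme_cacheBits (hr : 1 ≤ r) (k : User H r) :
    (codedScheme H r N g b enc).cacheBits k = N * (K'' H r - r).choose (q H r g) * b := by
  change Fintype.card ((Fin N × {Q : Collection H r g // Caches k Q.1}) × Fin b) = _
  rw [Fintype.card_prod, Fintype.card_prod, card_cached hr, Fintype.card_fin, Fintype.card_fin]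

theorem codedScheme_relayBits (hr : 1 ≤ r) (d : Demand H r N) (h : Fin H) :
    (codedScheme H r N g b enc).relayBits d h = (K' H r).choose g * b := by
  change Fintype.card (Group H r g h × Fin b) = _
  rw [Fintype.card_prod, card_group hr, Fintype.card_fin]

theorem codedScheme_linkBits_le (hr : 1 ≤ r) (d : Demand H r N) (k : User H r)
    (h : {h : Fin H // h ∈ k.1}) :
    (codedScheme H r N g b enc).linkBits d k h ≤ (K' H r).choose g * b := by
  change Fintype.card ({J : Group H r g h.1 // k ∈ J.1} × Fin b) ≤ _
  rw [Fintype.card_prod, ← card_group hr h.1, Fintype.card_fin]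
  exact Nat.mul_le_mul_right _ (Fintype.card_subtype_le _)

end CodedScheme

theorem Scheme.errorProb_eq_zero {H r N : ℕ} {ι : Type} {s : Scheme H r N ι} {d : Demand H r N}
    (hs : ∀ W k, s.output d W k = W (d k)) : s.errorProb d = 0 := by
  have : {W : Files N ι | ∃ k, s.output d W k ≠ W (d k)} = ∅ := by
    ext W
    simp [hs W]
  rw [errorProb, this, Set.ncard_empty, Nat.cast_zero, zero_div]

/-! ### Existence of MDS codes -/

/-- Reed–Solomon codes over the field with `2 ^ b` elements. -/
theorem exists_isMDS (D : ℕ) {b : ℕ} {κ : Type} [Fintype κ] (hb : b ≠ 0)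
    (hκ : Fintype.card κ ≤ 2 ^ b) :
    ∃ enc : (Fin D → Fin b → Bit) → κ → Fin b → Bit, IsMDS enc := by
  have hcard : Nat.card (GaloisField 2 b) = 2 ^ b := GaloisField.card 2 b hb
  have : Fintype (GaloisField 2 b) := Fintype.ofFinite _
  rw [Nat.card_eq_fintype_card] at hcard
  obtain ⟨e⟩ : Nonempty ((Fin b → Bit) ≃ GaloisField 2 b) := by
    rw [← Fintype.card_eq, hcard]
    simp [ZMod.card]
  obtain ⟨α⟩ : Nonempty (κ ↪ GaloisField 2 b) :=
    Function.Embedding.nonempty_of_card_le (hκ.trans hcard.ge)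
  -- The pieces are the coefficients of a polynomial, evaluated at distinct points `α j`. Any `D`
  -- evaluations give an invertible Vandermonde system; `e` need only be a bijection.
  refine ⟨fun x j => e.symm (∑ i : Fin D, e (x i) * α j ^ (i : ℕ)), fun T hT x y hxy => ?_⟩
  let f : Fin D ≃ T := (T.equivFinOfCardEq hT).symm
  have hdet : (Matrix.vandermonde fun i => α (f i).1).det ≠ 0 :=
    Matrix.det_vandermonde_ne_zero_iff.mpr
      (α.injective.comp (Subtype.val_injective.comp f.injective))
  have hv : (Matrix.vandermonde fun i => α (f i).1).mulVec (fun i => e (x i) - e (y i)) = 0 := by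
    ext t
    have ht := e.symm.injective (congrFun hxy (f t))
    simp only [Matrix.mulVec, dotProduct, Matrix.vandermonde_apply, Pi.zero_apply, mul_sub,
      Finset.sum_sub_distrib, sub_eq_zero]
    simpa only [mul_comm] using ht
  funext i
  have := congrFun (Matrix.eq_zero_of_mulVec_eq_zero hdet hv) i
  exact e.injective (sub_eq_zero.mp this)

theorem eventually_exists_isMDS (D : ℕ) (κ : Type) [Fintype κ] :
    ∀ᶠ b : ℕ in atTop, ∃ enc : (Fin D → Fin b → Bit) → κ → Fin b → Bit, IsMDS enc := by
  filter_upwards [eventually_ge_atTop (Fintype.card κ), eventually_ge_atTop 1] with b hb hb1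
  exact exists_isMDS D (by omega) (hb.trans Nat.lt_two_pow_self.le)

/-! ### Operations on schemes -/

namespace Scheme

variable {H r N : ℕ} {ι κ : Type}

/-- Relabelling of the bits of the files. -/
def reindex (s : Scheme H r N ι) (e : ι ≃ κ) : Scheme H r N κ where
  CacheIx := s.CacheIx
  RelayIx := s.RelayIx
  LinkIx := s.LinkIx
  cacheFintype := s.cacheFintype
  relayFintype := s.relayFintype
  linkFintype := s.linkFintype
  place k W := s.place k fun i x => W i (e x)
  serverMsg d h W := s.serverMsg d h fun i x => W i (e x)
  relayMsg := s.relayMsg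
  decode d k z y x := s.decode d k z y (e.symm x)

/-- The concatenation of two schemes, acting on two parts of the files. -/
def concat (s : Scheme H r N ι) (t : Scheme H r N κ) : Scheme H r N (ι ⊕ κ) where
  CacheIx k := s.CacheIx k ⊕ t.CacheIx k
  RelayIx d h := s.RelayIx d h ⊕ t.RelayIx d h
  LinkIx d k h := s.LinkIx d k h ⊕ t.LinkIx d k h
  cacheFintype k := @instFintypeSum _ _ (s.cacheFintype k) (t.cacheFintype k)
  relayFintype d h := @instFintypeSum _ _ (s.relayFintype d h) (t.relayFintype d h)
  linkFintype d k h := @instFintypeSum _ _ (s.linkFintype d k h) (t.linkFintype d k h)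
  place k W := Sum.elim (s.place k fun i x => W i (.inl x)) (t.place k fun i x => W i (.inr x))
  serverMsg d h W := Sum.elim (s.serverMsg d h fun i x => W i (.inl x))
    (t.serverMsg d h fun i x => W i (.inr x))
  relayMsg d k h x := Sum.elim (s.relayMsg d k h (x ∘ .inl)) (t.relayMsg d k h (x ∘ .inr))
  decode d k z y := Sum.elim (s.decode d k (z ∘ .inl) fun h => y h ∘ .inl)
    (t.decode d k (z ∘ .inr) fun h => y h ∘ .inr)

/-- Uncoded delivery without caches: every relay receives all files and forwards to each user
the file that the user requests. -/
noncomputable def uncoded (H r N : ℕ) (ι : Type) [Fintype ι] : Scheme H r N ι where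
  CacheIx _ := Empty
  RelayIx _ _ := Fin N × ι
  LinkIx _ _ _ := ι
  cacheFintype _ := inferInstance
  relayFintype _ _ := inferInstance
  linkFintype _ _ _ := inferInstance
  place _ _ := Empty.elim
  serverMsg _ _ W p := W p.1 p.2
  relayMsg d k _ x i := x (d k, i)
  -- Any one connected relay suffices; the value `0` is used only when `r = 0`.
  decode _ k _ y i := if hk : k.1.Nonempty then y ⟨hk.choose, hk.choose_spec⟩ i else 0

end Scheme

/-- There is a scheme without errors for files with bits indexed by `ι` in which every cache has
at most `c` bits and every link carries at most `l` bits. -/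
def HasScheme (H r N : ℕ) (ι : Type) (c l : ℕ) : Prop :=
  ∃ s : Scheme H r N ι, (∀ k, s.cacheBits k ≤ c) ∧ (∀ d h, s.relayBits d h ≤ l) ∧
    (∀ d k h, s.linkBits d k h ≤ l) ∧ ∀ d W k, s.output d W k = W (d k)

namespace HasScheme

variable {H r N : ℕ} {ι κ : Type} {c c' l l' : ℕ}

theorem reindex (hs : HasScheme H r N ι c l) (e : ι ≃ κ) : HasScheme H r N κ c l := by
  obtain ⟨s, h1, h2, h3, h4⟩ := hs
  refine ⟨s.reindex e, h1, h2, h3, fun d W k => funext fun x => ?_⟩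
  refine (congrFun (h4 d (fun i x => W i (e x)) k) (e.symm x)).trans ?_
  simp

theorem concat (hs : HasScheme H r N ι c l) (ht : HasScheme H r N κ c' l') :
    HasScheme H r N (ι ⊕ κ) (c + c') (l + l') := by
  obtain ⟨s, h1, h2, h3, h4⟩ := hs
  obtain ⟨t, h1', h2', h3', h4'⟩ := ht
  refine ⟨s.concat t, fun k => ?_, fun d h => ?_, fun d k h => ?_, fun d W k => ?_⟩
  · exact (@Fintype.card_sum _ _ (s.cacheFintype k) (t.cacheFintype k)).trans_le
      (add_le_add (h1 k) (h1' k))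
  · exact (@Fintype.card_sum _ _ (s.relayFintype d h) (t.relayFintype d h)).trans_le
      (add_le_add (h2 d h) (h2' d h))
  · exact (@Fintype.card_sum _ _ (s.linkFintype d k h) (t.linkFintype d k h)).trans_le
      (add_le_add (h3 d k h) (h3' d k h))
  · funext x
    cases x with
    | inl x => exact congrFun (h4 d (fun i x => W i (.inl x)) k) x
    | inr x => exact congrFun (h4' d (fun i x => W i (.inr x)) k) x

theorem concat_fin {m n : ℕ} (hs : HasScheme H r N (Fin m) c l)
    (ht : HasScheme H r N (Fin n) c' l') : HasScheme H r N (Fin (m + n)) (c + c') (l + l') :=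
  (hs.concat ht).reindex finSumFinEquiv

theorem uncoded (hr : 1 ≤ r) (hN : 1 ≤ N) (n : ℕ) : HasScheme H r N (Fin n) 0 (N * n) := by
  refine ⟨Scheme.uncoded H r N (Fin n), fun k => ?_, fun d h => ?_, fun d k h => ?_,
    fun d W k => ?_⟩
  · exact (Fintype.card_empty).le
  · change Fintype.card (Fin N × Fin n) ≤ _
    simp
  · change Fintype.card (Fin n) ≤ _
    rw [Fintype.card_fin]
    exact Nat.le_mul_of_pos_left n hN
  · have hk : k.1.Nonempty := Finset.card_pos.mp (by rw [k.2]; exact hr)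
    funext i
    exact dif_pos hk

theorem coded {g b : ℕ} (hr : 1 ≤ r) (hg : g ∈ Set.Icc 2 (K' H r))
    {enc : (Fin (numPieces H r g) → Fin b → Bit) → Collection H r g → Fin b → Bit}
    (henc : IsMDS enc) :
    HasScheme H r N (Fin (numPieces H r g * b)) (N * (K'' H r - r).choose (q H r g) * b)
      ((K' H r).choose g * b) :=
  HasScheme.reindex ⟨codedScheme H r N g b enc, fun k => (codedScheme_cacheBits hr k).le,
    fun d h => (codedScheme_relayBits hr d h).le, codedScheme_linkBits_le hr,
    codedScheme_output hr hg henc⟩ finProdFinEquiv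

end HasScheme

/-! ### Memory sharing and the zero-error region -/

/-- The pairs of nonnegative numbers that are achievable without errors. -/
def exactRegion (H r N : ℕ) : Set (ℝ × ℝ) :=
  {p | 0 ≤ p.1 ∧ 0 ≤ p.2 ∧ ∀ ε : ℝ, 0 < ε → ∀ᶠ B : ℕ in atTop, ∃ c l : ℕ,
    HasScheme H r N (Fin B) c l ∧ (c : ℝ) ≤ p.1 * B ∧ (l : ℝ) ≤ (p.2 + ε) * B}

variable {H r N : ℕ}

/-- Memory sharing. -/
theorem convex_exactRegion (hr : 1 ≤ r) (hN : 1 ≤ N) : Convex ℝ (exactRegion H r N) := by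
  refine convex_iff_forall_pos.mpr ?_
  rintro ⟨M, R⟩ ⟨hM, hR, hp⟩ ⟨M', R'⟩ ⟨hM', hR', hp'⟩ a a' ha ha' haa
  simp only at hM hR hp hM' hR' hp'
  simp only [Prod.smul_mk, Prod.mk_add_mk, smul_eq_mul]
  refine ⟨by positivity, by positivity, fun ε hε => ?_⟩
  have htend : ∀ t : ℝ, 0 < t → Tendsto (fun B : ℕ => ⌊t * B⌋₊) atTop atTop := fun t ht =>
    tendsto_nat_floor_atTop.comp (tendsto_natCast_atTop_atTop.const_mul_atTop ht)
  have hbig : ∀ᶠ B : ℕ in atTop, 2 * N / (ε / 2) ≤ (B : ℝ) :=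
    tendsto_natCast_atTop_atTop.eventually_ge_atTop _
  filter_upwards [(htend a ha).eventually (hp (ε / 2) (half_pos hε)),
    (htend a' ha').eventually (hp' (ε / 2) (half_pos hε)), hbig] with B h1 h2 h3
  obtain ⟨c, l, hs, hc, hl⟩ := h1
  obtain ⟨c', l', hs', hc', hl'⟩ := h2
  have f1 := Nat.floor_le (a := a * (B : ℝ)) (by positivity)
  have f2 := Nat.floor_le (a := a' * (B : ℝ)) (by positivity)
  have f3 := Nat.lt_floor_add_one (a * (B : ℝ))
  have f4 := Nat.lt_floor_add_one (a' * (B : ℝ))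
  have hB : a * B + a' * B = (B : ℝ) := by rw [← add_mul, haa, one_mul]
  -- The `n ≤ 2` bits left by the two floors are sent uncoded. They must use no cache, since the
  -- memory bound has no slack; their load of at most `2 N` bits fits into `ε / 2 * B`.
  obtain ⟨n, hn⟩ : ∃ n, B = ⌊a * (B : ℝ)⌋₊ + ⌊a' * (B : ℝ)⌋₊ + n := by
    refine Nat.exists_eq_add_of_le ?_
    exact_mod_cast (show ((⌊a * (B : ℝ)⌋₊ : ℝ) + ⌊a' * (B : ℝ)⌋₊) ≤ B by linarith)
  have hn2 : (n : ℝ) ≤ 2 := by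
    have : (B : ℝ) = ⌊a * (B : ℝ)⌋₊ + ⌊a' * (B : ℝ)⌋₊ + n := by exact_mod_cast hn
    linarith
  have key := (hs.concat_fin hs').concat_fin (HasScheme.uncoded hr hN n)
  rw [← hn] at key
  refine ⟨_, _, key, ?_, ?_⟩
  · push_cast
    have g1 := mul_le_mul_of_nonneg_left f1 hM
    have g2 := mul_le_mul_of_nonneg_left f2 hM'
    linarith
  · push_cast
    have g1 := mul_le_mul_of_nonneg_left f1 (show 0 ≤ R + ε / 2 by positivity)
    have g2 := mul_le_mul_of_nonneg_left f2 (show 0 ≤ R' + ε / 2 by positivity)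
    have g3 : (N : ℝ) * n ≤ 2 * N := by
      rw [mul_comm]
      exact mul_le_mul_of_nonneg_right hn2 (Nat.cast_nonneg N)
    rw [div_le_iff₀' (half_pos hε)] at h3
    have e : (a * R + a' * R' + ε) * (B : ℝ) = (R + ε / 2) * (a * B) + (R' + ε / 2) * (a' * B) +
        ε / 2 * B := by
      linear_combination (-ε / 2) * hB
    linarith

theorem points_subset_exactRegion (hr : 1 ≤ r) (hrH : r ≤ H) (hN : 1 ≤ N) :
    points H r N ⊆ exactRegion H r N := by
  rintro _ ⟨g, hg, rfl⟩
  have hD := numPieces_pos hr hg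
  have hD' : (0 : ℝ) < numPieces H r g := by exact_mod_cast hD
  have hm := memory_mul_numPieces N hr hg
  have hl := load_mul_numPieces hr hrH hN hg
  have hm0 : 0 ≤ memory H r N g := nonneg_of_mul_nonneg_left (hm ▸ by positivity) hD'
  have hl0 : 0 ≤ load H r N g := nonneg_of_mul_nonneg_left (hl ▸ by positivity) hD'
  refine ⟨hm0, hl0, fun ε hε => ?_⟩
  have hbig : ∀ᶠ B : ℕ in atTop, N * numPieces H r g / ε ≤ (B : ℝ) :=
    tendsto_natCast_atTop_atTop.eventually_ge_atTop _
  have hdiv : Tendsto (fun B : ℕ => B / numPieces H r g) atTop atTop :=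
    Nat.tendsto_div_const_atTop hD.ne'
  filter_upwards [hdiv.eventually (eventually_exists_isMDS (numPieces H r g) (Collection H r g)),
    hbig] with B ⟨enc, henc⟩ hB
  -- With `b = B / D_g`, the remaining `B % D_g` bits per file go uncoded, costing no cache and at
  -- most `N D_g ≤ ε B` bits per link.
  have key := (HasScheme.coded (N := N) hr hg henc).concat_fin
    (HasScheme.uncoded hr hN (B % numPieces H r g))
  rw [Nat.div_add_mod] at key
  have hb : (numPieces H r g : ℝ) * (B / numPieces H r g : ℕ) ≤ B := by
    exact_mod_cast Nat.mul_div_le B (numPieces H r g)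
  refine ⟨_, _, key, ?_, ?_⟩
  · push_cast
    rw [← hm, add_zero, mul_assoc]
    exact mul_le_mul_of_nonneg_left hb hm0
  · push_cast
    rw [← hl, mul_assoc, add_mul]
    refine add_le_add (mul_le_mul_of_nonneg_left hb hl0) ?_
    rw [div_le_iff₀' hε] at hB
    refine le_trans (mul_le_mul_of_nonneg_left ?_ (Nat.cast_nonneg N)) hB
    exact_mod_cast (Nat.mod_lt B hD).le

/-- Half of `ε` pays for approximating `R` from within the region and half for the slack of the
scheme, so the infimum defining the envelope need not be attained. -/
theorem achievable_of_forall_exists_lt {M R : ℝ}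
    (h : ∀ ε : ℝ, 0 < ε → ∃ y < R + ε, (M, y) ∈ exactRegion H r N) : Achievable H r N M R := by
  intro ε hε
  obtain ⟨y, hy, -, -, hp⟩ := h (ε / 2) (half_pos hε)
  filter_upwards [hp (ε / 2) (half_pos hε), eventually_gt_atTop 0] with B ⟨c, l, hs, hc, hl⟩ hB
  obtain ⟨s, h1, h2, h3, h4⟩ := hs
  have hB' : (0 : ℝ) < B := by exact_mod_cast hB
  have hload : ∀ n : ℕ, n ≤ l → (n : ℝ) / B ≤ R + ε := fun n hn => by
    rw [div_le_iff₀ hB']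
    have hn' : (n : ℝ) ≤ l := by exact_mod_cast hn
    refine (hn'.trans hl).trans (mul_le_mul_of_nonneg_right ?_ hB'.le)
    linarith
  refine ⟨s, fun k => le_trans (by exact_mod_cast h1 k) hc, ?_, fun d => ?_⟩
  · rintro _ (⟨d, h, rfl⟩ | ⟨d, k, h, rfl⟩) <;> rw [Fintype.card_fin]
    · exact hload _ (h2 d h)
    · exact hload _ (h3 d k h)
  · rw [Scheme.errorProb_eq_zero (h4 d)]
    exact hε.le

theorem codedScheme_isGreatest_loads {g b : ℕ} (hr : 1 ≤ r) (hrH : r ≤ H) (hN : 1 ≤ N)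
    (hg : g ∈ Set.Icc 2 (K' H r)) (hb : 1 ≤ b)
    (enc : (Fin (numPieces H r g) → Fin b → Bit) → Collection H r g → Fin b → Bit) :
    IsGreatest (codedScheme H r N g b enc).loads (load H r N g) := by
  have hD' : (0 : ℝ) < numPieces H r g := by exact_mod_cast numPieces_pos hr hg
  have hb' : (0 : ℝ) < b := by exact_mod_cast hb
  have hl : load H r N g = ((K' H r).choose g * b : ℕ) /
      (Fintype.card (Fin (numPieces H r g) × Fin b) : ℝ) := by
    rw [Fintype.card_prod, Fintype.card_fin, Fintype.card_fin, Nat.cast_mul (numPieces H r g),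
      eq_div_iff (mul_pos hD' hb').ne']
    push_cast
    rw [← mul_assoc, load_mul_numPieces hr hrH hN hg]
  rw [hl]
  constructor
  -- Every server–relay link carries the same number of bits for every demand, so any link attains
  -- the maximum.
  · refine Or.inl ⟨fun _ => ⟨0, hN⟩, ⟨0, hr.trans hrH⟩, ?_⟩
    rw [codedScheme_relayBits hr]
  · rintro _ (⟨d, h, rfl⟩ | ⟨d, k, h, rfl⟩)
    · rw [codedScheme_relayBits hr]
    · gcongr
      exact codedScheme_linkBits_le hr d k h

end CombNet

theorem mainTheorem1 (H r N : ℕ) (hr : 1 ≤ r) (hrH : r ≤ H) (hN : 1 ≤ N) :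
    (∀ M ∈ Prod.fst '' convexHull ℝ (CombNet.points H r N),
      CombNet.Achievable H r N M (CombNet.lowerConvexEnvelope (CombNet.points H r N) M)) ∧
    (∀ g ∈ Set.Icc 2 (CombNet.K' H r),
      (∀ (b : ℕ) (enc : (Fin (CombNet.numPieces H r g) → Fin b → CombNet.Bit) →
          CombNet.Collection H r g → Fin b → CombNet.Bit), 1 ≤ b → CombNet.IsMDS enc →
        (∀ k, ((CombNet.codedScheme H r N g b enc).cacheBits k : ℝ) =
          CombNet.memory H r N g * ((CombNet.numPieces H r g * b : ℕ) : ℝ)) ∧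
        IsGreatest (CombNet.codedScheme H r N g b enc).loads (CombNet.load H r N g) ∧
        (∀ d, (CombNet.codedScheme H r N g b enc).errorProb d = 0)) ∧
      (∀ᶠ b : ℕ in Filter.atTop,
        ∃ enc : (Fin (CombNet.numPieces H r g) → Fin b → CombNet.Bit) →
          CombNet.Collection H r g → Fin b → CombNet.Bit, CombNet.IsMDS enc)) := by
  refine ⟨?_, fun g hg => ⟨fun b enc hb henc => ⟨fun k => ?_, ?_, fun d => ?_⟩, ?_⟩⟩
  · rintro M ⟨⟨M, y⟩, hy, rfl⟩
    refine CombNet.achievable_of_forall_exists_lt fun ε hε => ?_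
    obtain ⟨z, hz, hlt⟩ := exists_lt_of_csInf_lt
      (s := {y | (M, y) ∈ convexHull ℝ (CombNet.points H r N)}) ⟨y, hy⟩ (lt_add_of_pos_right _ hε)
    exact ⟨z, hlt, convexHull_min (CombNet.points_subset_exactRegion hr hrH hN)
      (CombNet.convex_exactRegion hr hN) hz⟩
  · rw [CombNet.codedScheme_cacheBits hr]
    push_cast
    rw [← mul_assoc, CombNet.memory_mul_numPieces N hr hg]
  · exact CombNet.codedScheme_isGreatest_loads hr hrH hN hg hb enc
  · exact CombNet.Scheme.errorProb_eq_zero (CombNet.codedScheme_output hr hg henc d)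
  · exact CombNet.eventually_exists_isMDS _ _
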